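/- Let $J(10,3)$ be the Johnson graph: its vertices are the $3$-element subsets of a $10$-element set $V$, two of them being adjacent when they share exactly two points. A \emph{perfect $2$-coloring} of $J(10,3)$ with quotient matrix $\begin{bmatrix}12&9\\9&12\end{bmatrix}$ is a partition $\{X_1,X_2\}$ of its vertices into two nonempty parts such that every vertex has exactly $12$ neighbours in its own part and exactly $9$ neighbours in the other part. A part $X$ has \emph{type} $k\in\{0,1,2\}$ if for all distinct $a,b\in V$ the number of $x\in X$ with $\{a,b\}\subset x$ is congruent to $k$ modulo $3$. Two colorings are \emph{isomorphic} if an automorphism of $J(10,3)$ maps the parts of one onto the parts of the other, in some order. Take for $V$ the vertex set of the cycle graph on $10$ vertices, with graph distance $d$, and let $T(p,q,r)$ be the set of all triples $\{a,b,c\}\subset V$ with $d(a,b)=p$, $d(b,c)=q$, $d(a,c)=r$. Put $$P_1=T(1,1,2)\cup T(1,2,3)\cup T(1,3,4)\cup T(3,3,4),\qquad P_2=T(1,4,5)\cup T(2,2,4)\cup T(2,3,5)\cup T(2,4,4).$$ **Theorem.** $\{P_1,P_2\}$ is a perfect $2$-coloring of $J(10,3)$ with quotient matrix $\begin{bmatrix}12&9\\9&12\end{bmatrix}$,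 $P_1$ has type $0$ and $P_2$ has type $2$. Every perfect $2$-coloring of $J(10,3)$ with this quotient matrix that has a part of type $0$ is isomorphic to $\{P_1,P_2\}$, and so is every one that has a part of type $2$. Thus, up to isomorphism, there is exactly one such coloring with a part of type $0$, and it is also the only one with a part of type $2$. -/

import Mathlib

/-- The Johnson graph `J(n,k)`: the vertices are the `k`-element subsets of an `n`-element set,
and `x`, `y` are adjacent when `|x ∩ y| = k - 1`. -/
def johnsonGraph (n k : ℕ) : SimpleGraph {s : Finset (Fin n) // s.card = k} where
  Adj x y := (x.1 ∩ y.1).card + 1 = k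
  symm := ⟨fun x y h => by rwa [Finset.inter_comm]⟩
  loopless := ⟨fun x h => by
    have hx := x.2
    rw [Finset.inter_self] at h
    omega⟩

/-- The parts `P 0, …, P (m-1)` form a perfect `m`-coloring of the graph `G` with quotient
matrix `Q`: they are nonempty, every vertex lies in exactly one part, and every vertex of `P i`
has exactly `Q i j` neighbours in `P j`. -/
def IsPerfectColoring {V : Type*} (G : SimpleGraph V) {m : ℕ} (P : Fin m → Set V)
    (Q : Matrix (Fin m) (Fin m) ℕ) : Prop :=
  (∀ i, (P i).Nonempty) ∧ (∀ x, ∃! i, x ∈ P i) ∧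
    ∀ i j, ∀ x ∈ P i, (G.neighborSet x ∩ P j).Finite ∧ (G.neighborSet x ∩ P j).ncard = Q i j

/-- Two colorings (families of parts) of `G` are isomorphic when an automorphism of `G` carries
the parts of the first one onto the parts of the second one, in some order. -/
def ColoringsIsomorphic {V : Type*} (G : SimpleGraph V) {m : ℕ} (P P' : Fin m → Set V) : Prop :=
  ∃ (φ : G ≃g G) (π : Equiv.Perm (Fin m)), ∀ i, φ '' P i = P' (π i)

/-- The vertex set of `J(10,3)`. -/
abbrev Triple : Type := {s : Finset (Fin 10) // s.card = 3}

/-- A set `X` of vertices of `J(10,3)` is of type `k ∈ {0,1,2}` when for all distinct points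
`a`, `b` the number of elements of `X` that contain both `a` and `b` is congruent to `k`
modulo 3. -/
def HasType (X : Set Triple) (k : Fin 3) : Prop :=
  ∀ a b : Fin 10, a ≠ b → {x : Triple | a ∈ x.1 ∧ b ∈ x.1 ∧ x ∈ X}.ncard ≡ (k : ℕ) [MOD 3]

/-- The triples `{a,b,c}` of vertices of the cycle graph on 10 vertices with
`d(a,b) = p`, `d(b,c) = q` and `d(a,c) = r`. -/
def cycleTriples (p q r : ℕ) : Set Triple :=
  {x | ∃ a b c : Fin 10, x.1 = {a, b, c} ∧ (SimpleGraph.cycleGraph 10).dist a b = p ∧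
    (SimpleGraph.cycleGraph 10).dist b c = q ∧ (SimpleGraph.cycleGraph 10).dist a c = r}

/-- The union of the orbits `A`, `B`, `C` and `H` of the automorphism group of the 10-cycle. -/
def cycleP₁ : Set Triple :=
  cycleTriples 1 1 2 ∪ cycleTriples 1 2 3 ∪ cycleTriples 1 3 4 ∪ cycleTriples 3 3 4

/-- The union of the orbits `D`, `E`, `F` and `G` of the automorphism group of the 10-cycle. -/
def cycleP₂ : Set Triple :=
  cycleTriples 1 4 5 ∪ cycleTriples 2 2 4 ∪ cycleTriples 2 3 5 ∪ cycleTriples 2 4 4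

/-!
A perfect coloring as in the theorem is governed by the pair degrees `λ(a,b)`, the number of
triples of a part `X` through `a` and `b`. A neighbour of a triple `{a,b,c}` contains exactly one
of its pairs, so the numbers `12` and `9` say that `λ(a,b) + λ(b,c) + λ(a,c)` is `15` if
`{a,b,c} ∈ X` and `9` otherwise (`pairDegree_add_add`). In particular `λ` determines `X`
(`IsEquitablePart.mem_iff`), and summing over `c` gives `∑ b, λ(a,b) = 36` for every point `a`
(`IsEquitablePart.sum_pairDegree`).

If `X` has type `0`, then `λ` takes values in `{0, 3, 6}`. As the sum over a triangle is odd,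
"`a = b` or `λ(a,b) = 3`" is an equivalence relation with at most two classes
(`IsEquitablePart.eq_three_iff`), and as it is at least `9`, no point has two pairs of degree `0`.
With the sum `36` at each point this forces two classes of five points, matched perfectly by
the pairs of degree `0` (`IsEquitablePart.card_cls_and_exists`). Any two such configurations differ
by a permutation of the points; so `X` is unique up to automorphism.

In the cycle the classes are the even and the odd vertices, and the matching is the antipodal one:
`cycleP₁` consists of the triples that meet both parity classes and contain no antipodal pair
(`mem_cycleP₁`). Its pair degrees give, through the same identity, that it belongs to a perfect
coloring. A part has type `2` exactly when the other one has type `0`, since eight triples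
contain a given pair.
-/

/-! ### Pair degrees -/

/-- The number of triples of `X` through the two points `a` and `b`. -/
noncomputable def pairDegree (X : Set Triple) (a b : Fin 10) : ℕ :=
  {x : Triple | a ∈ x.1 ∧ b ∈ x.1 ∧ x ∈ X}.ncard

lemma pairDegree_comm (X : Set Triple) (a b : Fin 10) : pairDegree X a b = pairDegree X b a := by
  unfold pairDegree
  congr 1
  ext x
  simp only [Set.mem_ofPred_eq]
  tauto

open Classical in
lemma ncard_setOf_eq_sum {α : Type*} [Fintype α] (p : α → Prop) :
    {x | p x}.ncard = ∑ x, if p x then 1 else 0 := by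
  rw [Set.ncard_eq_toFinset_card', Set.toFinset_ofPred, Finset.card_filter]

lemma Triple.exists_eq (x : Triple) :
    ∃ a b c : Fin 10, a ≠ b ∧ a ≠ c ∧ b ≠ c ∧ x.1 = {a, b, c} :=
  Finset.card_eq_three.1 x.2

lemma card_inter_triple {a b c : Fin 10} (hab : a ≠ b) (hac : a ≠ c) (hbc : b ≠ c)
    (y : Finset (Fin 10)) : (({a, b, c} : Finset (Fin 10)) ∩ y).card =
      (if a ∈ y then 1 else 0) + (if b ∈ y then 1 else 0) + if c ∈ y then 1 else 0 := by
  rw [← Finset.filter_mem_eq_inter, Finset.card_filter, Finset.sum_insert (by simp [hab, hac]),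
    Finset.sum_insert (by simp [hbc]), Finset.sum_singleton, add_assoc]

open Classical in
/-- Double counting of the triples of `X` that meet `x = {a, b, c}` in at least two points:
a neighbour of `x` contains one of the three pairs, and `x` itself contains all of them. -/
lemma pairDegree_add_add (X : Set Triple) {a b c : Fin 10} (hab : a ≠ b) (hac : a ≠ c)
    (hbc : b ≠ c) {x : Triple} (hx : x.1 = {a, b, c}) :
    pairDegree X a b + pairDegree X b c + pairDegree X a c =
      ((johnsonGraph 10 3).neighborSet x ∩ X).ncard + if x ∈ X then 3 else 0 := by
  have h1 : ((johnsonGraph 10 3).neighborSet x ∩ X) =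
      {y | (x.1 ∩ y.1).card + 1 = 3 ∧ y ∈ X} := rfl
  have h2 : (if x ∈ X then 3 else 0) =
      ∑ y : Triple, if x = y then (if y ∈ X then 3 else 0) else 0 := by
    simp
  rw [h1, h2]
  simp only [pairDegree, ncard_setOf_eq_sum, ← Finset.sum_add_distrib]
  refine Finset.sum_congr rfl fun y _ => ?_
  have h3 : x = y ↔ a ∈ y.1 ∧ b ∈ y.1 ∧ c ∈ y.1 := by
    constructor
    · rintro rfl
      simp [hx]
    · rintro ⟨ha, hb, hc⟩
      refine Subtype.ext (Finset.eq_of_subset_of_card_le ?_ (by rw [x.2, y.2]))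
      rw [hx]
      simp [Finset.insert_subset_iff, ha, hb, hc]
  rw [hx, card_inter_triple hab hac hbc]
  simp only [h3]
  by_cases hX : y ∈ X <;> by_cases ha : a ∈ y.1 <;> by_cases hb : b ∈ y.1 <;>
    by_cases hc : c ∈ y.1 <;> simp [hX, ha, hb, hc]

/-- A triple through `a` and `b` is given by its third point. -/
lemma pairDegree_eq_sum (X : Set Triple) (p : Fin 10 → Prop) [DecidablePred p] {a b : Fin 10}
    (hab : a ≠ b)
    (hp : ∀ c, a ≠ c → b ≠ c → ∀ x : Triple, x.1 = {a, b, c} → (x ∈ X ↔ p c)) :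
    pairDegree X a b = ∑ c ∈ ({a, b} : Finset (Fin 10))ᶜ, if p c then 1 else 0 := by
  classical
  have hcard : ∀ c, a ≠ c → b ≠ c → ({a, b, c} : Finset (Fin 10)).card = 3 := fun c hac hbc =>
    Finset.card_eq_three.2 ⟨a, b, c, hab, hac, hbc, rfl⟩
  rw [pairDegree, Set.ncard_eq_toFinset_card', Set.toFinset_ofPred, ← Finset.card_filter]
  symm
  have hmem : ∀ c ∈ ({a, b} : Finset (Fin 10))ᶜ.filter p, a ≠ c ∧ b ≠ c ∧ p c := by
    intro c hc
    simp only [Finset.mem_filter, Finset.mem_compl, Finset.mem_insert, Finset.mem_singleton,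
      not_or] at hc
    exact ⟨Ne.symm hc.1.1, Ne.symm hc.1.2, hc.2⟩
  refine Finset.card_bij
    (fun c hc => ⟨{a, b, c}, hcard c (hmem c hc).1 (hmem c hc).2.1⟩) ?_ ?_ ?_
  · intro c hc
    obtain ⟨h1, h2, h3⟩ := hmem c hc
    simpa using (hp c h1 h2 _ rfl).2 h3
  · intro c hc d hd h
    obtain ⟨h1, h2, -⟩ := hmem c hc
    have h4 : c ∈ ({a, b, d} : Finset (Fin 10)) := by
      rw [← Subtype.mk.inj h]; simp
    simpa [h1.symm, h2.symm] using h4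
  · intro x hx
    simp only [Finset.mem_filter, Finset.mem_univ, true_and] at hx
    obtain ⟨ha, hb, hX⟩ := hx
    have hsub : ({a, b} : Finset (Fin 10)) ⊆ x.1 := by simp [Finset.insert_subset_iff, ha, hb]
    have h1 : (x.1 \ {a, b}).card = 1 := by
      rw [Finset.card_sdiff_of_subset hsub, x.2, Finset.card_pair hab]
    obtain ⟨c, hc⟩ := Finset.card_eq_one.1 h1
    have hc' : c ∈ x.1 \ {a, b} := by simp [hc]
    simp only [Finset.mem_sdiff, Finset.mem_insert, Finset.mem_singleton, not_or] at hc'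
    have hac : a ≠ c := Ne.symm hc'.2.1
    have hbc : b ≠ c := Ne.symm hc'.2.2
    have hx : x.1 = {a, b, c} := by
      symm
      refine Finset.eq_of_subset_of_card_le ?_ (by rw [x.2, hcard c hac hbc])
      simp [Finset.insert_subset_iff, ha, hb, hc'.1]
    refine ⟨c, ?_, Subtype.ext hx.symm⟩
    simp only [Finset.mem_filter, Finset.mem_compl, Finset.mem_insert, Finset.mem_singleton,
      not_or]
    exact ⟨hc'.2, (hp c hac hbc x hx).1 hX⟩

lemma pairDegree_univ {a b : Fin 10} (hab : a ≠ b) : pairDegree Set.univ a b = 8 := by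
  rw [pairDegree_eq_sum Set.univ (fun _ => True) hab (by simp)]
  rw [Finset.sum_congr rfl fun c _ => if_pos trivial, Finset.sum_const, Finset.card_compl,
    Finset.card_pair hab, Fintype.card_fin]
  rfl

lemma pairDegree_add_compl (X : Set Triple) {a b : Fin 10} (hab : a ≠ b) :
    pairDegree X a b + pairDegree Xᶜ a b = 8 := by
  classical
  rw [← pairDegree_univ hab]
  simp only [pairDegree, ncard_setOf_eq_sum, ← Finset.sum_add_distrib]
  refine Finset.sum_congr rfl fun y _ => ?_
  by_cases hX : y ∈ X <;> simp [hX]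

lemma hasType_two_iff_compl (X : Set Triple) : HasType X 2 ↔ HasType Xᶜ 0 := by
  refine forall_congr' fun a => forall_congr' fun b => forall_congr' fun hab => ?_
  have h := pairDegree_add_compl X hab
  change pairDegree X a b ≡ 2 [MOD 3] ↔ pairDegree Xᶜ a b ≡ 0 [MOD 3]
  simp only [Nat.ModEq]
  omega

lemma hasType_zero_iff_compl (X : Set Triple) : HasType X 0 ↔ HasType Xᶜ 2 := by
  rw [hasType_two_iff_compl, compl_compl]

/-! ### Equitable parts -/

open Classical in
/-- A part of a perfect `2`-coloring of `J(10,3)` with quotient matrix `[[12, 9], [9, 12]]`. -/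
def IsEquitablePart (X : Set Triple) : Prop :=
  ∀ x, ((johnsonGraph 10 3).neighborSet x ∩ X).ncard = if x ∈ X then 12 else 9

namespace IsEquitablePart

variable {X : Set Triple} {a b c : Fin 10} {x : Triple}

lemma add_add_of_mem (hX : IsEquitablePart X) (hab : a ≠ b) (hac : a ≠ c) (hbc : b ≠ c)
    (hx : x.1 = {a, b, c}) (h : x ∈ X) :
    pairDegree X a b + pairDegree X b c + pairDegree X a c = 15 := by
  rw [pairDegree_add_add X hab hac hbc hx, hX x, if_pos h, if_pos h]

lemma add_add_of_notMem (hX : IsEquitablePart X) (hab : a ≠ b) (hac : a ≠ c) (hbc : b ≠ c)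
    (hx : x.1 = {a, b, c}) (h : x ∉ X) :
    pairDegree X a b + pairDegree X b c + pairDegree X a c = 9 := by
  rw [pairDegree_add_add X hab hac hbc hx, hX x, if_neg h, if_neg h]

lemma add_add (hX : IsEquitablePart X) (hab : a ≠ b) (hac : a ≠ c) (hbc : b ≠ c) :
    pairDegree X a b + pairDegree X b c + pairDegree X a c = 9 ∨
      pairDegree X a b + pairDegree X b c + pairDegree X a c = 15 := by
  by_cases h : (⟨{a, b, c}, Finset.card_eq_three.2 ⟨a, b, c, hab, hac, hbc, rfl⟩⟩ : Triple) ∈ X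
  · exact .inr (hX.add_add_of_mem hab hac hbc rfl h)
  · exact .inl (hX.add_add_of_notMem hab hac hbc rfl h)

/-- An equitable part is determined by its pair degrees. -/
lemma mem_iff (hX : IsEquitablePart X) (hab : a ≠ b) (hac : a ≠ c) (hbc : b ≠ c)
    (hx : x.1 = {a, b, c}) :
    x ∈ X ↔ pairDegree X a b + pairDegree X b c + pairDegree X a c = 15 := by
  refine ⟨hX.add_add_of_mem hab hac hbc hx, fun h => ?_⟩
  by_contra hn
  rw [hX.add_add_of_notMem hab hac hbc hx hn] at h
  omega

lemma sum_add_sum (hX : IsEquitablePart X) (hab : a ≠ b) :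
    ∑ c ∈ {a}ᶜ, pairDegree X a c + ∑ c ∈ {b}ᶜ, pairDegree X b c = 72 := by
  have h1 := pairDegree_eq_sum X
    (fun c => pairDegree X a b + pairDegree X b c + pairDegree X a c = 15) hab
    fun c hac hbc x hx => hX.mem_iff hab hac hbc hx
  have h2 : ∑ c ∈ ({a, b} : Finset (Fin 10))ᶜ,
      (pairDegree X a b + pairDegree X b c + pairDegree X a c) =
      ∑ c ∈ ({a, b} : Finset (Fin 10))ᶜ, (9 + 6 *
        if pairDegree X a b + pairDegree X b c + pairDegree X a c = 15 then 1 else 0) := by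
    refine Finset.sum_congr rfl fun c hc => ?_
    simp only [Finset.mem_compl, Finset.mem_insert, Finset.mem_singleton, not_or] at hc
    rcases hX.add_add hab (Ne.symm hc.1) (Ne.symm hc.2) with h | h <;> rw [h] <;> rfl
  have hcard : ({a, b} : Finset (Fin 10))ᶜ.card = 8 := by
    rw [Finset.card_compl, Finset.card_pair hab, Fintype.card_fin]
  rw [Finset.sum_add_distrib, Finset.sum_add_distrib, Finset.sum_add_distrib, ← Finset.mul_sum,
    ← h1, Finset.sum_const, Finset.sum_const, hcard] at h2
  have ha : ({a} : Finset (Fin 10))ᶜ = insert b {a, b}ᶜ := by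
    ext c
    simp only [Finset.mem_compl, Finset.mem_insert, Finset.mem_singleton]
    by_cases hc : c = b
    · simp [hc, hab.symm]
    · simp [hc]
  have hb : ({b} : Finset (Fin 10))ᶜ = insert a {a, b}ᶜ := by
    ext c
    simp only [Finset.mem_compl, Finset.mem_insert, Finset.mem_singleton]
    by_cases hc : c = a
    · simp [hc, hab]
    · simp [hc]
  rw [ha, hb, Finset.sum_insert (by simp), Finset.sum_insert (by simp), pairDegree_comm X b a]
  simp only [smul_eq_mul] at h2
  omega

/-- The sums `S a` over the pairs at a point satisfy `S a + S b = 72` for all `a ≠ b`, so that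
they are all equal. -/
lemma sum_pairDegree (hX : IsEquitablePart X) (a : Fin 10) :
    ∑ b ∈ {a}ᶜ, pairDegree X a b = 36 := by
  obtain ⟨b, c, hab, hac, hbc⟩ : ∃ b c : Fin 10, a ≠ b ∧ a ≠ c ∧ b ≠ c := by
    revert a; decide
  have h1 := hX.sum_add_sum hab
  have h2 := hX.sum_add_sum hac
  have h3 := hX.sum_add_sum hbc
  omega

end IsEquitablePart

/-! ### Parts of type `0` -/

/-- The pair degrees of `cycleP₁`, divided by `3`, off the diagonal: `0` for antipodal points,
`1` for points of equal parity, `2` for the other pairs. -/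
def cycleWeight (i j : Fin 10) : ℕ :=
  if j = i + 5 then 0 else if i.val % 2 = j.val % 2 then 1 else 2

namespace IsEquitablePart

variable {X : Set Triple} {a b c : Fin 10}

lemma pairDegree_cases (h0 : HasType X 0) (hab : a ≠ b) :
    pairDegree X a b = 0 ∨ pairDegree X a b = 3 ∨ pairDegree X a b = 6 := by
  have h1 := pairDegree_add_compl X hab
  have h2 : pairDegree X a b ≡ 0 [MOD 3] := h0 a b hab
  simp only [Nat.ModEq] at h2
  omega

/-- Two points in the same class are joined by pairs of degree `3`; there are two classes. -/
lemma eq_three_iff (hX : IsEquitablePart X) (h0 : HasType X 0) (hab : a ≠ b) (hac : a ≠ c)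
    (hbc : b ≠ c) :
    pairDegree X b c = 3 ↔ (pairDegree X a b = 3 ↔ pairDegree X a c = 3) := by
  have h1 := hX.add_add hab hac hbc
  have h2 := pairDegree_cases h0 hab
  have h3 := pairDegree_cases h0 hac
  have h4 := pairDegree_cases h0 hbc
  omega

lemma unique_of_eq_zero (hX : IsEquitablePart X) (h0 : HasType X 0) (hab : a ≠ b) (hac : a ≠ c)
    (hb : pairDegree X a b = 0) (hc : pairDegree X a c = 0) : b = c := by
  by_contra hbc
  have h1 := hX.add_add hab hac hbc
  have h4 := pairDegree_cases h0 hbc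
  omega

/-- The numbers `n₀`, `n₃`, `n₆` of pairs of degree `0`, `3`, `6` at a point satisfy
`n₀ + n₃ + n₆ = 9` and `3 n₃ + 6 n₆ = 36`. -/
lemma card_pairDegree (hX : IsEquitablePart X) (h0 : HasType X 0) (a : Fin 10) :
    ({b ∈ ({a} : Finset (Fin 10))ᶜ | pairDegree X a b = 3}).card +
      2 * ({b ∈ ({a} : Finset (Fin 10))ᶜ | pairDegree X a b = 0}).card = 6 := by
  have h1 := hX.sum_pairDegree a
  have h2 : ∑ b ∈ ({a} : Finset (Fin 10))ᶜ, (pairDegree X a b +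
      3 * (if pairDegree X a b = 3 then 1 else 0) +
      6 * (if pairDegree X a b = 0 then 1 else 0)) = ∑ b ∈ ({a} : Finset (Fin 10))ᶜ, 6 := by
    refine Finset.sum_congr rfl fun b hb => ?_
    have hab : a ≠ b := by simpa [eq_comm] using hb
    rcases pairDegree_cases h0 hab with h | h | h <;> simp [h]
  simp only [Finset.sum_add_distrib, ← Finset.mul_sum, ← Finset.card_filter, Finset.sum_const,
    h1, Finset.card_compl, Finset.card_singleton, Fintype.card_fin] at h2
  simp only [smul_eq_mul] at h2
  omega

open Classical in
/-- The class of `a`: the points joined to `a` by a pair of degree `3`, and `a` itself. -/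
noncomputable def cls (X : Set Triple) (a : Fin 10) : Finset (Fin 10) :=
  {b | b = a ∨ pairDegree X a b = 3}

lemma mem_cls : b ∈ cls X a ↔ b = a ∨ pairDegree X a b = 3 := by simp [cls]

lemma card_cls (X : Set Triple) (a : Fin 10) : (cls X a).card =
    ({b ∈ ({a} : Finset (Fin 10))ᶜ | pairDegree X a b = 3}).card + 1 := by
  rw [← Finset.card_insert_of_notMem (a := a) (by simp)]
  congr 1
  ext b
  by_cases hb : b = a <;> simp [mem_cls, hb]

lemma cls_eq_compl (hX : IsEquitablePart X) (h0 : HasType X 0) (hb : b ∉ cls X a) :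
    cls X b = (cls X a)ᶜ := by
  simp only [mem_cls, not_or] at hb
  have hab : a ≠ b := Ne.symm hb.1
  ext c
  simp only [Finset.mem_compl, mem_cls, not_or]
  by_cases hcb : c = b
  · simp [hcb, hb]
  by_cases hca : c = a
  · simp [hca, hab, pairDegree_comm X b a, hb.2]
  have h := hX.eq_three_iff h0 hab (Ne.symm hca) (Ne.symm hcb)
  simp [hcb, hca, h, hb.2]

/-- Both classes have five points, as their sizes are in `{5, 7}` and have sum `10`; so a
point has exactly one pair of degree `0`. -/
lemma card_cls_and_exists (hX : IsEquitablePart X) (h0 : HasType X 0) (a : Fin 10) :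
    (cls X a).card = 5 ∧ ∃ b, a ≠ b ∧ pairDegree X a b = 0 := by
  have hle : ∀ a, ({b ∈ ({a} : Finset (Fin 10))ᶜ | pairDegree X a b = 0}).card ≤ 1 := by
    refine fun a => Finset.card_le_one.2 fun b hb c hc => ?_
    simp only [Finset.mem_filter, Finset.mem_compl, Finset.mem_singleton] at hb hc
    exact hX.unique_of_eq_zero h0 (Ne.symm hb.1) (Ne.symm hc.1) hb.2 hc.2
  have key : ∀ a, (cls X a).card +
      2 * ({b ∈ ({a} : Finset (Fin 10))ᶜ | pairDegree X a b = 0}).card = 7 := fun a => by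
    have := hX.card_pairDegree h0 a
    rw [card_cls]
    omega
  have h1 := key a
  have h2 := hle a
  obtain ⟨b, hb⟩ : ∃ b, b ∉ cls X a := by
    by_contra! h
    have h3 : (cls X a).card = 10 := by rw [Finset.eq_univ_of_forall h]; simp
    omega
  have h3 := key b
  have h4 := hle b
  have h5 := Finset.card_add_card_compl (cls X a)
  rw [← hX.cls_eq_compl h0 hb, Fintype.card_fin] at h5
  refine ⟨by omega, ?_⟩
  obtain ⟨c, hc⟩ := Finset.card_pos.1
    (show 0 < ({b ∈ ({a} : Finset (Fin 10))ᶜ | pairDegree X a b = 0}).card by omega)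
  simp only [Finset.mem_filter, Finset.mem_compl, Finset.mem_singleton] at hc
  exact ⟨c, Ne.symm hc.1, hc.2⟩

/-- The points can be labelled by the vertices of the `10`-cycle so that the two classes become
the two parity classes and pairs of degree `0` become antipodal pairs. -/
lemma exists_perm (hX : IsEquitablePart X) (h0 : HasType X 0) :
    ∃ σ : Equiv.Perm (Fin 10), ∀ i j, i ≠ j → pairDegree X (σ i) (σ j) = 3 * cycleWeight i j := by
  obtain ⟨hcard, -⟩ := hX.card_cls_and_exists h0 0
  choose m hm hm0 using fun a => (hX.card_cls_and_exists h0 a).2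
  let e := ((cls X 0).equivFinOfCardEq hcard).symm
  have hmem : ∀ k, (e k : Fin 10) ∈ cls X 0 := fun k => (e k).2
  have he : ∀ {k l}, k ≠ l → (e k : Fin 10) ≠ e l := fun h h' =>
    h (e.injective (Subtype.ext h'))
  have same : ∀ {a b}, a ≠ b → (pairDegree X a b = 3 ↔ (a ∈ cls X 0 ↔ b ∈ cls X 0)) := by
    intro a b hab
    simp only [mem_cls]
    by_cases ha : a = 0
    · subst ha
      simp [hab.symm]
    by_cases hb : b = 0
    · subst hb
      simp [ha, pairDegree_comm X a 0]
    simpa [ha, hb] using hX.eq_three_iff h0 (Ne.symm ha) (Ne.symm hb) hab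
  have hmm : ∀ k, m (e k) ∉ cls X 0 := fun k h => by
    have := (same (hm (e k))).2 (iff_of_true (hmem k) h)
    rw [hm0] at this
    omega
  have hme : ∀ {k l}, k ≠ l → m (e k) ≠ m (e l) := by
    intro k l hkl h
    refine he hkl (hX.unique_of_eq_zero h0 (a := m (e k)) (hm _).symm ?_ ?_ ?_)
    · rw [h]; exact (hm _).symm
    · rw [pairDegree_comm, hm0]
    · rw [h, pairDegree_comm, hm0]
  have hem : ∀ k l, (e k : Fin 10) ≠ m (e l) := fun k l h => hmm l (h ▸ hmem k)
  have d1 : ∀ {k l}, k ≠ l → pairDegree X (e k) (e l) = 3 := fun h =>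
    (same (he h)).2 (iff_of_true (hmem _) (hmem _))
  have d2 : ∀ {k l}, k ≠ l → pairDegree X (m (e k)) (m (e l)) = 3 := fun h =>
    (same (hme h)).2 (iff_of_false (hmm _) (hmm _))
  have d3 : ∀ k l, pairDegree X (e k) (m (e l)) = if k = l then 0 else 6 := by
    intro k l
    split_ifs with hkl
    · rw [hkl, hm0]
    · rcases pairDegree_cases h0 (hem k l) with h | h | h
      · exact absurd (hX.unique_of_eq_zero h0 (hem k l) (hm _) h (hm0 _)) (hme (Ne.symm hkl))
      · exact absurd ((same (hem k l)).1 h) (by simp [hmem k, hmm l])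
      · exact h
  -- Vertices `2k` go to `e k`, their antipodes `2k + 5` to the partner of `e k`.
  let half : Fin 10 → Fin 5 := ![0, 3, 1, 4, 2, 0, 3, 1, 4, 2]
  let τ : Fin 10 → Fin 10 := fun i => if i.val % 2 = 0 then e (half i) else m (e (half i))
  have hw : ∀ i j : Fin 10, i ≠ j → cycleWeight i j =
      if i.val % 2 = j.val % 2 then 1 else if half i = half j then 0 else 2 := by decide
  have hh : ∀ i j : Fin 10, i ≠ j → i.val % 2 = j.val % 2 → half i ≠ half j := by decide
  have hinj : Function.Injective τ := by
    intro i j h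
    by_contra hij
    have := hh i j hij
    rcases Nat.mod_two_eq_zero_or_one i with hi | hi <;>
      rcases Nat.mod_two_eq_zero_or_one j with hj | hj <;> simp only [τ, hi, hj] at h this
    · exact he (this trivial) h
    · exact hem _ _ h
    · exact hem _ _ h.symm
    · exact hme (this trivial) h
  refine ⟨Equiv.ofBijective τ (Finite.injective_iff_bijective.1 hinj), fun i j hij => ?_⟩
  have := hh i j hij
  rw [hw i j hij]
  change pairDegree X (τ i) (τ j) = _
  rcases Nat.mod_two_eq_zero_or_one i with hi | hi <;>
    rcases Nat.mod_two_eq_zero_or_one j with hj | hj <;> simp only [τ, hi, hj] at this ⊢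
  · exact d1 (this trivial)
  · simp [d3]
  · simp [pairDegree_comm X (m _), d3, eq_comm]
  · exact d2 (this trivial)

end IsEquitablePart

/-! ### Automorphisms -/

/-- The automorphism of a Johnson graph induced by a permutation of the points. -/
def johnsonGraphAut {n : ℕ} (k : ℕ) (σ : Equiv.Perm (Fin n)) :
    johnsonGraph n k ≃g johnsonGraph n k where
  toEquiv := σ.finsetCongr.subtypeEquiv fun s => by simp
  map_rel_iff' := by
    intro x y
    simp [johnsonGraph, ← Finset.map_inter]

lemma johnsonGraphAut_apply {n k : ℕ} (σ : Equiv.Perm (Fin n))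
    (x : {s : Finset (Fin n) // s.card = k}) :
    (johnsonGraphAut k σ x).1 = x.1.map σ.toEmbedding := rfl

/-- Equitable parts with the same pair degrees, up to a relabelling of the points, differ by an
automorphism of the Johnson graph. -/
lemma IsEquitablePart.preimage_aut {X Y : Set Triple} (hX : IsEquitablePart X)
    (hY : IsEquitablePart Y) (σ : Equiv.Perm (Fin 10))
    (h : ∀ i j, i ≠ j → pairDegree X (σ i) (σ j) = pairDegree Y i j) :
    johnsonGraphAut 3 σ ⁻¹' X = Y := by
  ext x
  obtain ⟨a, b, c, hab, hac, hbc, hx⟩ := Triple.exists_eq x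
  rw [Set.mem_preimage, hY.mem_iff hab hac hbc hx,
    hX.mem_iff (a := σ a) (b := σ b) (c := σ c) (by simpa) (by simpa) (by simpa)
      (by rw [johnsonGraphAut_apply, hx]; simp), h a b hab, h b c hbc, h a c hac]

/-! ### The coloring of the cycle -/

/-- The distance from `w` is the only function that vanishes just at `w`, grows by at most one
along edges and can be decreased by one along some edge elsewhere. -/
lemma SimpleGraph.dist_eq_of_forall_adj {V : Type*} {G : SimpleGraph V} {w : V} {h : V → ℕ}
    (h0 : ∀ u, h u = 0 ↔ u = w) (hadj : ∀ u v, G.Adj u v → h u ≤ h v + 1)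
    (hdesc : ∀ u, u ≠ w → ∃ v, G.Adj u v ∧ h v + 1 = h u) (u : V) : G.dist u w = h u := by
  have lower : ∀ {u v : V} (p : G.Walk u v), h u ≤ h v + p.length := by
    intro u v p
    induction p with
    | nil => simp
    | cons huv p ih =>
      have := hadj _ _ huv
      simp only [SimpleGraph.Walk.length_cons]
      omega
  have upper : ∀ n u, h u = n → ∃ p : G.Walk u w, p.length = n := by
    intro n
    induction n with
    | zero =>
      intro u hu
      obtain rfl := (h0 u).1 hu
      exact ⟨.nil, rfl⟩
    | succ n ih =>
      intro u hu
      have hne : u ≠ w := fun h' => by rw [(h0 u).2 h'] at hu; omega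
      obtain ⟨v, huv, hv⟩ := hdesc u hne
      obtain ⟨p, hp⟩ := ih v (by omega)
      exact ⟨.cons huv p, by simp [hp]⟩
  obtain ⟨p, hp⟩ := upper _ u rfl
  refine le_antisymm (hp ▸ SimpleGraph.dist_le p) ?_
  obtain ⟨q, hq⟩ := p.reachable.exists_walk_length_eq_dist
  have := lower q
  rw [(h0 w).2 rfl] at this
  omega

/-- The distance in the cycle on ten vertices. -/
def cycleDist (i j : Fin 10) : ℕ := min (i - j).val (j - i).val

lemma cycleGraph_dist (i j : Fin 10) : (SimpleGraph.cycleGraph 10).dist i j = cycleDist i j := by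
  refine SimpleGraph.dist_eq_of_forall_adj (h := fun i => cycleDist i j) ?_ ?_ ?_ i
  · revert j; decide
  · simp only [SimpleGraph.cycleGraph_adj]
    revert j; decide +kernel
  · simp only [SimpleGraph.cycleGraph_adj]
    revert j; decide +kernel

lemma mem_cycleTriples {p q r : ℕ} {x : Triple} : x ∈ cycleTriples p q r ↔
    ∃ a b c : Fin 10, x.1 = {a, b, c} ∧
      (cycleDist a b, cycleDist b c, cycleDist a c) = (p, q, r) := by
  simp [cycleTriples, cycleGraph_dist]

/-- A set of points that meets both parity classes and contains no antipodal pair. -/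
def IsCrossing (s : Finset (Fin 10)) : Prop :=
  (∃ a ∈ s, ∃ b ∈ s, a.val % 2 ≠ b.val % 2) ∧ ∀ a ∈ s, ∀ b ∈ s, b ≠ a + 5

instance : DecidablePred IsCrossing := fun _ => inferInstanceAs (Decidable (_ ∧ _))

lemma mem_union_cycleTriples {d₁ d₂ d₃ d₄ : ℕ × ℕ × ℕ} {x : Triple} :
    x ∈ cycleTriples d₁.1 d₁.2.1 d₁.2.2 ∪ cycleTriples d₂.1 d₂.2.1 d₂.2.2 ∪
      cycleTriples d₃.1 d₃.2.1 d₃.2.2 ∪ cycleTriples d₄.1 d₄.2.1 d₄.2.2 ↔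
    ∃ a b c : Fin 10, x.1 = {a, b, c} ∧
      (cycleDist a b, cycleDist b c, cycleDist a c) ∈ [d₁, d₂, d₃, d₄] := by
  simp only [Set.mem_union, mem_cycleTriples, List.mem_cons, List.not_mem_nil, or_false,
    and_or_left, exists_or, or_assoc]

/-- If the triples with distances in `[d₁, d₂, d₃, d₄]`, up to the order of the points, are those
with the property `P`, then so are the members of the union of the sets `cycleTriples`. -/
lemma mem_union_cycleTriples_iff {d₁ d₂ d₃ d₄ : ℕ × ℕ × ℕ} {P : Finset (Fin 10) → Prop}
    (h1 : ∀ a b c : Fin 10, (cycleDist a b, cycleDist b c, cycleDist a c) ∈ [d₁, d₂, d₃, d₄] →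
      P {a, b, c})
    (h2 : ∀ a b c : Fin 10, a ≠ b → a ≠ c → b ≠ c → P {a, b, c} →
      ∃ t ∈ [(a, b, c), (a, c, b), (b, a, c), (b, c, a), (c, a, b), (c, b, a)],
        (cycleDist t.1 t.2.1, cycleDist t.2.1 t.2.2, cycleDist t.1 t.2.2) ∈ [d₁, d₂, d₃, d₄])
    {x : Triple} :
    x ∈ cycleTriples d₁.1 d₁.2.1 d₁.2.2 ∪ cycleTriples d₂.1 d₂.2.1 d₂.2.2 ∪
      cycleTriples d₃.1 d₃.2.1 d₃.2.2 ∪ cycleTriples d₄.1 d₄.2.1 d₄.2.2 ↔ P x.1 := by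
  rw [mem_union_cycleTriples]
  constructor
  · rintro ⟨a, b, c, hx, h⟩
    exact hx ▸ h1 a b c h
  · intro h
    obtain ⟨a, b, c, hab, hac, hbc, hx⟩ := Triple.exists_eq x
    obtain ⟨⟨p, q, r⟩, ht, hd⟩ := h2 a b c hab hac hbc (hx ▸ h)
    refine ⟨p, q, r, ?_, hd⟩
    rw [hx]
    simp only [List.mem_cons, Prod.mk.injEq, List.not_mem_nil, or_false] at ht
    rcases ht with ⟨rfl, rfl, rfl⟩ | ⟨rfl, rfl, rfl⟩ | ⟨rfl, rfl, rfl⟩ | ⟨rfl, rfl, rfl⟩ |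
      ⟨rfl, rfl, rfl⟩ | ⟨rfl, rfl, rfl⟩ <;>
      first | rfl | (ext; simp only [Finset.mem_insert, Finset.mem_singleton]; tauto)

lemma mem_cycleP₁ {x : Triple} : x ∈ cycleP₁ ↔ IsCrossing x.1 :=
  mem_union_cycleTriples_iff (d₁ := (1, 1, 2)) (d₂ := (1, 2, 3)) (d₃ := (1, 3, 4))
    (d₄ := (3, 3, 4)) (by decide +kernel) (by decide +kernel)

lemma mem_cycleP₂ {x : Triple} : x ∈ cycleP₂ ↔ ¬ IsCrossing x.1 :=
  mem_union_cycleTriples_iff (d₁ := (1, 4, 5)) (d₂ := (2, 2, 4)) (d₃ := (2, 3, 5))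
    (d₄ := (2, 4, 4)) (P := fun s => ¬ IsCrossing s) (by decide +kernel) (by decide +kernel)

lemma cycleP₂_eq_compl : cycleP₂ = cycleP₁ᶜ := by
  ext x
  rw [Set.mem_compl_iff, mem_cycleP₁, mem_cycleP₂]

lemma pairDegree_cycleP₁ {i j : Fin 10} (hij : i ≠ j) :
    pairDegree cycleP₁ i j = 3 * cycleWeight i j := by
  rw [pairDegree_eq_sum cycleP₁ (fun c => IsCrossing {i, j, c}) hij
    fun c _ _ x hx => by rw [mem_cycleP₁, hx]]
  revert i j
  decide +kernel

lemma isEquitablePart_cycleP₁ : IsEquitablePart cycleP₁ := by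
  intro x
  obtain ⟨a, b, c, hab, hac, hbc, hx⟩ := Triple.exists_eq x
  have h := pairDegree_add_add cycleP₁ hab hac hbc hx
  rw [pairDegree_cycleP₁ hab, pairDegree_cycleP₁ hac, pairDegree_cycleP₁ hbc] at h
  have hw : ∀ a b c : Fin 10, a ≠ b → a ≠ c → b ≠ c →
      cycleWeight a b + cycleWeight b c + cycleWeight a c =
        if IsCrossing {a, b, c} then 5 else 3 := by decide +kernel
  have h' := hw a b c hab hac hbc
  by_cases hm : x ∈ cycleP₁
  · rw [if_pos hm] at h ⊢
    rw [mem_cycleP₁, hx] at hm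
    rw [if_pos hm] at h'
    omega
  · rw [if_neg hm] at h ⊢
    rw [mem_cycleP₁, hx] at hm
    rw [if_neg hm] at h'
    omega

/-! ### Perfect colorings and their parts -/

/-- `J(10,3)` is regular of degree `21`. -/
lemma ncard_neighborSet_add_compl (X : Set Triple) (x : Triple) :
    ((johnsonGraph 10 3).neighborSet x ∩ X).ncard +
      ((johnsonGraph 10 3).neighborSet x ∩ Xᶜ).ncard = 21 := by
  obtain ⟨a, b, c, hab, hac, hbc, hx⟩ := Triple.exists_eq x
  have h := pairDegree_add_add Set.univ hab hac hbc hx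
  rw [pairDegree_univ hab, pairDegree_univ hac, pairDegree_univ hbc, if_pos (Set.mem_univ x),
    Set.inter_univ] at h
  have h' := Set.ncard_inter_add_ncard_sdiff_eq_ncard ((johnsonGraph 10 3).neighborSet x) X
    (Set.toFinite _)
  rw [Set.sdiff_eq] at h'
  omega

lemma IsEquitablePart.compl {X : Set Triple} (hX : IsEquitablePart X) : IsEquitablePart Xᶜ := by
  intro x
  have h1 := hX x
  have h2 := ncard_neighborSet_add_compl X x
  by_cases hx : x ∈ X
  · rw [if_pos hx] at h1
    rw [if_neg (by simpa using hx)]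
    omega
  · rw [if_neg hx] at h1
    rw [if_pos (by simpa using hx)]
    omega

lemma IsEquitablePart.nonempty {X : Set Triple} (hX : IsEquitablePart X) : X.Nonempty := by
  by_contra h
  rw [Set.not_nonempty_iff_eq_empty] at h
  have := hX ⟨{0, 1, 2}, rfl⟩
  simp [h] at this

lemma IsEquitablePart.isPerfectColoring {X : Set Triple} (hX : IsEquitablePart X) :
    IsPerfectColoring (johnsonGraph 10 3) ![X, Xᶜ] !![12, 9; 9, 12] := by
  refine ⟨?_, ?_, ?_⟩
  · simp [Fin.forall_fin_two, hX.nonempty, hX.compl.nonempty]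
  · intro x
    by_cases hx : x ∈ X
    · exact ⟨0, hx, by simp [Fin.forall_fin_two, hx]⟩
    · exact ⟨1, hx, by simp [Fin.forall_fin_two, hx]⟩
  · refine fun i j x hx => ⟨Set.toFinite _, ?_⟩
    have h1 := hX x
    have h2 := hX.compl x
    fin_cases i <;> fin_cases j <;> simp_all

lemma IsPerfectColoring.eq_compl {X : Fin 2 → Set Triple}
    (hX : IsPerfectColoring (johnsonGraph 10 3) X !![12, 9; 9, 12]) : X 1 = (X 0)ᶜ := by
  ext x
  obtain ⟨i, hi, hu⟩ := hX.2.1 x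
  constructor
  · intro h1 h0
    exact absurd ((hu 0 h0).trans (hu 1 h1).symm) (by decide)
  · intro h0
    fin_cases i
    · exact absurd hi h0
    · exact hi

lemma IsPerfectColoring.isEquitablePart {X : Fin 2 → Set Triple}
    (hX : IsPerfectColoring (johnsonGraph 10 3) X !![12, 9; 9, 12]) :
    IsEquitablePart (X 0) := by
  intro x
  split_ifs with h
  · exact (hX.2.2 0 0 x h).2
  · have h1 : x ∈ X 1 := by rwa [hX.eq_compl]
    exact (hX.2.2 1 0 x h1).2

lemma IsEquitablePart.exists_aut {X : Set Triple} (hX : IsEquitablePart X) (h0 : HasType X 0) :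
    ∃ φ : johnsonGraph 10 3 ≃g johnsonGraph 10 3, φ '' X = cycleP₁ ∧ φ '' Xᶜ = cycleP₂ := by
  obtain ⟨σ, hσ⟩ := hX.exists_perm h0
  have h := hX.preimage_aut isEquitablePart_cycleP₁ σ fun i j hij => by
    rw [hσ i j hij, pairDegree_cycleP₁ hij]
  have himg : (johnsonGraphAut 3 σ).symm '' X = cycleP₁ := by
    rw [← h]
    exact (johnsonGraphAut 3 σ).toEquiv.image_symm_eq_preimage X
  refine ⟨(johnsonGraphAut 3 σ).symm, himg, ?_⟩
  rw [Set.image_compl_eq (johnsonGraphAut 3 σ).symm.bijective, himg, cycleP₂_eq_compl]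

lemma coloringsIsomorphic_of_hasType_zero {X : Fin 2 → Set Triple}
    (hX : IsPerfectColoring (johnsonGraph 10 3) X !![12, 9; 9, 12])
    (h : ∃ i, HasType (X i) 0) :
    ColoringsIsomorphic (johnsonGraph 10 3) X ![cycleP₁, cycleP₂] := by
  have hc := hX.eq_compl
  obtain ⟨i, hi⟩ := h
  fin_cases i
  · obtain ⟨φ, h1, h2⟩ := hX.isEquitablePart.exists_aut hi
    exact ⟨φ, 1, by simp [Fin.forall_fin_two, hc, h1, h2]⟩
  · simp only [Fin.mk_one, hc] at hi
    obtain ⟨φ, h1, h2⟩ := hX.isEquitablePart.compl.exists_aut hi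
    rw [compl_compl] at h2
    exact ⟨φ, Equiv.swap 0 1, by simp [Fin.forall_fin_two, hc, h1, h2]⟩

theorem theorem1 :
    (IsPerfectColoring (johnsonGraph 10 3) ![cycleP₁, cycleP₂] !![12, 9; 9, 12] ∧
      HasType cycleP₁ 0 ∧ HasType cycleP₂ 2) ∧
    (∀ X : Fin 2 → Set Triple, IsPerfectColoring (johnsonGraph 10 3) X !![12, 9; 9, 12] →
      (∃ i, HasType (X i) 0) →
      ColoringsIsomorphic (johnsonGraph 10 3) X ![cycleP₁, cycleP₂]) ∧
    (∀ X : Fin 2 → Set Triple, IsPerfectColoring (johnsonGraph 10 3) X !![12, 9; 9, 12] →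
      (∃ i, HasType (X i) 2) →
      ColoringsIsomorphic (johnsonGraph 10 3) X ![cycleP₁, cycleP₂]) := by
  have h0 : HasType cycleP₁ 0 := fun i j hij => by
    change pairDegree cycleP₁ i j ≡ 0 [MOD 3]
    rw [pairDegree_cycleP₁ hij]
    exact (Nat.modEq_zero_iff_dvd).2 (dvd_mul_right 3 _)
  refine ⟨⟨?_, h0, ?_⟩, fun X hX => coloringsIsomorphic_of_hasType_zero hX, ?_⟩
  · rw [cycleP₂_eq_compl]
    exact isEquitablePart_cycleP₁.isPerfectColoring
  · rwa [cycleP₂_eq_compl, ← hasType_zero_iff_compl]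
  · rintro X hX ⟨i, hi⟩
    refine coloringsIsomorphic_of_hasType_zero hX ?_
    have hc := hX.eq_compl
    rw [hasType_two_iff_compl] at hi
    fin_cases i
    · exact ⟨1, by rw [hc]; exact hi⟩
    · refine ⟨0, ?_⟩
      simpa only [Fin.mk_one, hc, compl_compl] using hi
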